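/- Write $\mathrm{Aff}(n)=\mathbb{R}^n\rtimes\mathrm{GL}(n;\mathbb{R})$ and $\mathrm{Euc}(n)=\mathbb{R}^n\rtimes\mathrm{O}(n)$. A Bieberbach group is a discrete, torsion-free subgroup $\Gamma$ of $\mathrm{Euc}(n)$ for which the quotient $\mathbb{R}^n/\Gamma$ is a closed manifold. Let $\mathcal{R}_f(\Gamma)$ be the space of injective homomorphisms $\rho\colon\Gamma\to\mathrm{Aff}(n)$ whose image $\rho(\Gamma)$ is conjugate in $\mathrm{Aff}(n)$ to a Bieberbach group in $\mathrm{Euc}(n)$, with the subspace topology induced from the representation space $\mathrm{Hom}(\Gamma,\mathrm{Aff}(n))$ (the topology of pointwise convergence on $\Gamma$). For a maximal compact subgroup $K$ of $\mathrm{GL}(n;\mathbb{R})$ let $\mathrm{O}_K(n)=\mathbb{R}^n\rtimes K\le\mathrm{Aff}(n)$ and $\mathrm{O}_K(n;\mathbb{Z})=\mathrm{O}_K(n)\cap(\mathbb{Z}^n\rtimes\mathrm{GL}(n;\mathbb{Z}))$. Call $\mathrm{O}_K(n)$ $\mathbb{Q}$-defined if $K=\mathrm{O}(B)$ for a symmetric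 positive definite bilinear form $B$ on $\mathbb{R}^n$ that takes rational values on $\mathbb{Q}^n\times\mathbb{Q}^n$. Let $\mathcal{R}_f(\Gamma;\mathbb{Q})$ be the set of those $\rho\in\mathcal{R}_f(\Gamma)$ for which there is a $\mathbb{Q}$-defined group $\mathrm{O}_K(n)$ such that $\rho(\Gamma)$ is contained in $\mathrm{O}_K(n)$ and commensurable with $\mathrm{O}_K(n;\mathbb{Z})$ (that is, $\rho(\Gamma)\cap\mathrm{O}_K(n;\mathbb{Z})$ has finite index in both groups). Then, for every Bieberbach group $\Gamma\le\mathrm{Euc}(n)$, $\mathcal{R}_f(\Gamma;\mathbb{Q})$ is dense in $\mathcal{R}_f(\Gamma)$. -/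

import Mathlib

open Matrix

noncomputable section

/-- The affine group `Aff(n)` of `ℝⁿ`; multiplication is composition. -/
abbrev Aff (n : ℕ) : Type := (Fin n → ℝ) ≃ᵃ[ℝ] (Fin n → ℝ)

namespace Aff

variable {n : ℕ}

/-- The linear part of an affine bijection, as an invertible matrix, so that
`f x = lin f *ᵥ x + f 0`. -/
def lin : Aff n →* GL (Fin n) ℝ :=
  (Matrix.GeneralLinearGroup.toLin.trans
    (LinearMap.GeneralLinearGroup.generalLinearEquiv ℝ (Fin n → ℝ))).symm.toMonoidHom.comp
    AffineEquiv.linearHom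

theorem apply_eq (f : Aff n) (x : Fin n → ℝ) :
    f x = (lin f : Matrix (Fin n) (Fin n) ℝ) *ᵥ x + f 0 := by
  have h : (lin f : Matrix (Fin n) (Fin n) ℝ) *ᵥ x = f.linear x := by
    have h1 : (Matrix.GeneralLinearGroup.toLin.trans
        (LinearMap.GeneralLinearGroup.generalLinearEquiv ℝ (Fin n → ℝ))) (lin f) = f.linear :=
      (Matrix.GeneralLinearGroup.toLin.trans
        (LinearMap.GeneralLinearGroup.generalLinearEquiv ℝ (Fin n → ℝ))).apply_symm_apply f.linear
    rw [← h1]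
    rfl
  rw [h]
  have h2 := f.map_vadd 0 x
  simpa using h2

/-- The usual topology of `Aff(n) = ℝⁿ ⋊ GL(n, ℝ)`: the product topology of the translational part
`f 0 ∈ ℝⁿ` and the linear part `lin f ∈ GL(n, ℝ)`. -/
instance : TopologicalSpace (Aff n) :=
  TopologicalSpace.induced (fun f : Aff n => (f 0, lin f)) inferInstance

/-- The action of `Aff(n)` on `ℝⁿ` by evaluation. -/
instance : MulAction (Aff n) (Fin n → ℝ) where
  smul f x := f x
  one_smul _ := rfl
  mul_smul _ _ _ := rfl

end Aff

/-- The group `O(B) ≤ GL(n, ℝ)` of the bilinear form with Gram matrix `B` in the standard basis. -/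
def formGroup {n : ℕ} (B : Matrix (Fin n) (Fin n) ℝ) : Subgroup (GL (Fin n) ℝ) where
  carrier := {A | (A : Matrix (Fin n) (Fin n) ℝ)ᵀ * B * (A : Matrix (Fin n) (Fin n) ℝ) = B}
  one_mem' := by simp
  mul_mem' {A C} hA hC := by
    simp only [Set.mem_ofPred_eq, Units.val_mul, Matrix.transpose_mul] at hA hC ⊢
    calc (C : Matrix (Fin n) (Fin n) ℝ)ᵀ * (A : Matrix (Fin n) (Fin n) ℝ)ᵀ * B *
          ((A : Matrix (Fin n) (Fin n) ℝ) * (C : Matrix (Fin n) (Fin n) ℝ))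
        = (C : Matrix (Fin n) (Fin n) ℝ)ᵀ *
          ((A : Matrix (Fin n) (Fin n) ℝ)ᵀ * B * (A : Matrix (Fin n) (Fin n) ℝ)) *
          (C : Matrix (Fin n) (Fin n) ℝ) := by simp only [Matrix.mul_assoc]
      _ = B := by rw [hA, hC]
  inv_mem' {A} hA := by
    simp only [Set.mem_ofPred_eq] at hA ⊢
    have h1 : (A : Matrix (Fin n) (Fin n) ℝ) * ((A⁻¹ : GL (Fin n) ℝ) : Matrix _ _ ℝ) = 1 :=
      Units.mul_inv A
    have h2 : ((A⁻¹ : GL (Fin n) ℝ) : Matrix (Fin n) (Fin n) ℝ)ᵀ *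
        (A : Matrix (Fin n) (Fin n) ℝ)ᵀ = 1 := by
      rw [← Matrix.transpose_mul, h1, Matrix.transpose_one]
    calc ((A⁻¹ : GL (Fin n) ℝ) : Matrix (Fin n) (Fin n) ℝ)ᵀ * B *
          ((A⁻¹ : GL (Fin n) ℝ) : Matrix (Fin n) (Fin n) ℝ)
        = ((A⁻¹ : GL (Fin n) ℝ) : Matrix (Fin n) (Fin n) ℝ)ᵀ *
          ((A : Matrix (Fin n) (Fin n) ℝ)ᵀ * B * (A : Matrix (Fin n) (Fin n) ℝ)) *
          ((A⁻¹ : GL (Fin n) ℝ) : Matrix (Fin n) (Fin n) ℝ) := by rw [hA]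
      _ = (((A⁻¹ : GL (Fin n) ℝ) : Matrix (Fin n) (Fin n) ℝ)ᵀ *
          (A : Matrix (Fin n) (Fin n) ℝ)ᵀ) * B * ((A : Matrix (Fin n) (Fin n) ℝ) *
          ((A⁻¹ : GL (Fin n) ℝ) : Matrix (Fin n) (Fin n) ℝ)) := by
            simp only [Matrix.mul_assoc]
      _ = B := by rw [h1, h2, Matrix.one_mul, Matrix.mul_one]

/-- The subgroup `O_K(n) = ℝⁿ ⋊ K` of `Aff(n)`: the affine bijections with linear part in `K`. -/
def orthogonalAffine {n : ℕ} (K : Subgroup (GL (Fin n) ℝ)) : Subgroup (Aff n) :=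
  K.comap Aff.lin

/-- The Euclidean group `Euc(n) = ℝⁿ ⋊ O(n)`. -/
def Euc (n : ℕ) : Subgroup (Aff n) := orthogonalAffine (formGroup 1)

/-- `Γ` is a Bieberbach group: a discrete, torsion-free subgroup of `Euc(n)` with compact quotient
`ℝⁿ / Γ`. (A discrete torsion-free subgroup of `Euc(n)` acts freely and properly discontinuously,
so that `ℝⁿ / Γ` is a manifold, and it is closed exactly when it is compact.) -/
structure IsBieberbach {n : ℕ} (Γ : Subgroup (Aff n)) : Prop where
  le_euc : Γ ≤ Euc n
  discrete : DiscreteTopology Γ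
  torsionFree : ∀ γ ∈ Γ, γ ≠ 1 → ¬ IsOfFinOrder γ
  compact_quotient : CompactSpace (Quotient (MulAction.orbitRel Γ (Fin n → ℝ)))

/-- The `Aff(n)`-representation space `Hom(Γ, Aff(n))`, with the topology of pointwise convergence
on `Γ`. -/
instance {n : ℕ} (Γ : Subgroup (Aff n)) : TopologicalSpace (Γ →* Aff n) :=
  TopologicalSpace.induced (fun (ρ : Γ →* Aff n) (γ : Γ) => ρ γ) inferInstance

/-- The space `R_f(Γ)` of faithful representations of `Γ` in `Aff(n)` whose image is an
`Aff(n)`-conjugate of a Bieberbach group. -/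
def faithfulReps {n : ℕ} (Γ : Subgroup (Aff n)) : Set (Γ →* Aff n) :=
  {ρ | Function.Injective ρ ∧
    ∃ g : Aff n, IsBieberbach (ρ.range.map (MulAut.conj g).toMonoidHom)}

/-- `K` is a maximal compact subgroup of `GL(n, ℝ)`. -/
def IsMaximalCompact {n : ℕ} (K : Subgroup (GL (Fin n) ℝ)) : Prop :=
  Maximal (fun L : Subgroup (GL (Fin n) ℝ) => IsCompact (L : Set (GL (Fin n) ℝ))) K

/-- `K`, and with it `O_K(n)`, is `ℚ`-defined: `K = O(B)` for a symmetric positive definite form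
`B` that is `ℚ`-valued on `ℚⁿ`. -/
def IsQDefined {n : ℕ} (K : Subgroup (GL (Fin n) ℝ)) : Prop :=
  ∃ B : Matrix (Fin n) (Fin n) ℚ,
    (B.map (fun q : ℚ => (q : ℝ))).PosDef ∧ K = formGroup (B.map (fun q : ℚ => (q : ℝ)))

/-- The group `ℤⁿ ⋊ GL(n, ℤ)` of integral points of `Aff(n)`. -/
def affInt (n : ℕ) : Subgroup (Aff n) where
  carrier := {f | (∃ v : Fin n → ℤ, f 0 = fun i => (v i : ℝ)) ∧
    Aff.lin f ∈ (Matrix.GeneralLinearGroup.map (n := Fin n) (Int.castRingHom ℝ)).range}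
  one_mem' := ⟨⟨0, by ext i; simp⟩, by rw [map_one]; exact one_mem _⟩
  mul_mem' {f g} hf hg := by
    obtain ⟨⟨v, hv⟩, ⟨A, hA⟩⟩ := hf
    obtain ⟨⟨w, hw⟩, hg⟩ := hg
    refine ⟨⟨(A : Matrix (Fin n) (Fin n) ℤ) *ᵥ w + v, ?_⟩, ?_⟩
    · rw [AffineEquiv.coe_mul, Function.comp_apply, Aff.apply_eq f, hv, hw, ← hA]
      ext i
      simp [Matrix.mulVec, dotProduct]
    · rw [map_mul]
      exact mul_mem ⟨A, hA⟩ hg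
  inv_mem' {f} hf := by
    obtain ⟨⟨v, hv⟩, ⟨A, hA⟩⟩ := hf
    have hA' : Matrix.GeneralLinearGroup.map (n := Fin n) (Int.castRingHom ℝ) A⁻¹ =
        Aff.lin f⁻¹ := by rw [map_inv, map_inv, hA]
    refine ⟨⟨-(((A⁻¹ : GL (Fin n) ℤ) : Matrix (Fin n) (Fin n) ℤ) *ᵥ v), ?_⟩, ⟨A⁻¹, hA'⟩⟩
    have h0 : (f⁻¹ : Aff n) (f 0) = 0 := f.symm_apply_apply 0
    rw [Aff.apply_eq f⁻¹ (f 0), ← hA', hv] at h0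
    rw [eq_neg_of_add_eq_zero_right h0]
    ext i
    simp [Matrix.mulVec, dotProduct, Matrix.GeneralLinearGroup.map]

/-- `Δ` is a `ℚ`-arithmetic subgroup of `O_K(n)`: a subgroup of `O_K(n)` commensurable with
`O_K(n; ℤ)`. -/
def IsQArithmeticIn {n : ℕ} (K : Subgroup (GL (Fin n) ℝ)) (Δ : Subgroup (Aff n)) : Prop :=
  Δ ≤ orthogonalAffine K ∧ Δ.Commensurable (orthogonalAffine K ⊓ affInt n)

/-- The representation `ρ` is `ℚ`-arithmetic: its image is a `ℚ`-arithmetic subgroup of some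
`ℚ`-defined orthogonal affine group `O_K(n)`. -/
def IsQArithmetic {n : ℕ} {Γ : Subgroup (Aff n)} (ρ : Γ →* Aff n) : Prop :=
  ∃ K : Subgroup (GL (Fin n) ℝ), IsMaximalCompact K ∧ IsQDefined K ∧ IsQArithmeticIn K ρ.range

end

/-!
Let `ρ` be a faithful representation of `Γ` whose image `Δ` is conjugate to a Bieberbach group. The
proof exhibits `ρ` as a limit of `ℚ`-arithmetic representations that are conjugates of `ρ`.

By Bieberbach's first theorem (`IsCrystallographic.span_translations_eq_top`) the translations in a
Bieberbach group form a lattice of `ℝⁿ`. Hence `f Δ f⁻¹`, for a suitable affine map `f`, contains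
exactly the translations by `ℤⁿ` (`IsBieberbach.exists_isNormalized`). Its linear parts then are
integral matrices that preserve a positive definite form, so there are finitely many of them, and
they preserve a rational positive definite form as well: the sum of `Aᵀ A` over the linear parts `A`.
This makes `f Δ f⁻¹` commensurable with the integral points of its orthogonal affine group, and the
same remains true after conjugation by an affine map with rational linear part
(`IsNormalized.isQArithmeticIn_conj`). So the conjugate of `ρ` by a linear map `X` is `ℚ`-arithmetic
as soon as `X * (lin f)⁻¹` is rational. Such `X` are dense in `GL(n, ℝ)`, and the conjugate of `ρ`
by `X` tends to `ρ` as `X` tends to `1`.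

Bieberbach's theorem is proved after P. Buser: an element whose linear part is within `1 / 2` of the
identity is a translation (`IsCrystallographic.map_eq_one_of_norm_sub_one_le`), and there are
elements with linear part close to the identity that move the origin nearly in any prescribed
direction (`IsCrystallographic.exists_near_direction`).
-/

/-! ### Bieberbach's first theorem -/

/-- A group `G` acting on a Euclidean space `V` by the isometries `x ↦ L g x + c g`, discretely (and
faithfully) and cocompactly. The action is encoded by its linear part `L`, a homomorphism, and its
translational part `c`, a cocycle for `L`. Discreteness says that only the identity is close to the
identity; cocompactness says that the orbit of `0` is coarsely dense. -/
structure IsCrystallographic {G V : Type*} [Group G] [NormedAddCommGroup V]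
    [InnerProductSpace ℝ V] (L : G →* (V →L[ℝ] V)) (c : G → V) : Prop where
  norm_map : ∀ g x, ‖L g x‖ = ‖x‖
  cocycle : ∀ g h, c (g * h) = c g + L g (c h)
  discrete : ∃ ε > 0, ∀ g, ‖c g‖ < ε → ‖L g - 1‖ < ε → g = 1
  cocompact : ∃ d, ∀ x, ∃ g, ‖x - c g‖ ≤ d

namespace IsCrystallographic

variable {G V : Type*} [Group G] [NormedAddCommGroup V] [InnerProductSpace ℝ V]
  {L : G →* (V →L[ℝ] V)} {c : G → V}

theorem norm_le_one (h : IsCrystallographic L c) (g : G) : ‖L g‖ ≤ 1 :=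
  (L g).opNorm_le_bound zero_le_one fun x => by rw [h.norm_map, one_mul]

/-- Elements with close linear parts have a quotient whose linear part is close to `1`. -/
theorem norm_sub_one_mul_inv (h : IsCrystallographic L c) (g k : G) :
    ‖L (g * k⁻¹) - 1‖ ≤ ‖L g - L k‖ := by
  have h1 : L (g * k⁻¹) - 1 = (L g - L k) * L k⁻¹ := by
    rw [sub_mul, ← map_mul, ← map_mul, mul_inv_cancel, map_one]
  rw [h1]
  exact (norm_mul_le _ _).trans (mul_le_of_le_one_right (norm_nonneg _) (h.norm_le_one _))

theorem cocycle_mul_inv (h : IsCrystallographic L c) (g k : G) :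
    c (g * k⁻¹) = c g - L (g * k⁻¹) (c k) := by
  have := h.cocycle (g * k⁻¹) k
  rw [inv_mul_cancel_right] at this
  rw [this, add_sub_cancel_right]

theorem exists_subseq_cauchySeq [FiniteDimensional ℝ V] (h : IsCrystallographic L c) (u : ℕ → G) :
    ∃ φ : ℕ → ℕ, StrictMono φ ∧ CauchySeq fun k => L (u (φ k)) := by
  have : ProperSpace (V →L[ℝ] V) := FiniteDimensional.proper ℝ _
  obtain ⟨a, -, φ, hφ, ha⟩ := tendsto_subseq_of_bounded
    (Metric.isBounded_closedBall (x := (0 : V →L[ℝ] V)) (r := 1))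
    (x := fun k => L (u k)) (fun k => by simpa using h.norm_le_one (u k))
  exact ⟨φ, hφ, ha.cauchySeq⟩

/-- Only finitely many elements move the origin by at most `R`: among infinitely many, compactness
would give two distinct ones whose quotient is arbitrarily close to the identity. -/
theorem finite_norm_le [FiniteDimensional ℝ V] (h : IsCrystallographic L c) (R : ℝ) :
    {g | ‖c g‖ ≤ R}.Finite := by
  obtain ⟨ε, hε, hd⟩ := h.discrete
  by_contra hinf
  have hinf : {g | ‖c g‖ ≤ R}.Infinite := hinf
  let u : ℕ → G := fun k => hinf.natEmbedding _ k
  have huR : ∀ k, ‖c (u k)‖ ≤ R := fun k => (hinf.natEmbedding _ k).2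
  have hu : Function.Injective u :=
    Subtype.val_injective.comp (hinf.natEmbedding _).injective
  obtain ⟨φ, hφ, hL⟩ := h.exists_subseq_cauchySeq u
  have : ProperSpace V := FiniteDimensional.proper ℝ _
  obtain ⟨a, -, ψ, hψ, ha⟩ := tendsto_subseq_of_bounded
    (Metric.isBounded_closedBall (x := (0 : V)) (r := R))
    (x := fun k => c (u (φ k))) (fun k => by simpa using huR _)
  have hR : 0 ≤ R := (norm_nonneg _).trans (huR 0)
  have hη : 0 < ε / (2 * (1 + R)) := by positivity
  obtain ⟨N₁, hN₁⟩ := Metric.cauchySeq_iff.1 (hL.comp_tendsto hψ.tendsto_atTop) _ hη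
  obtain ⟨N₂, hN₂⟩ := Metric.cauchySeq_iff.1 ha.cauchySeq _ (half_pos hε)
  set N := max N₁ N₂
  have h1 := hN₁ N (le_max_left _ _) (N + 1) ((le_max_left _ _).trans N.le_succ)
  have h2 := hN₂ N (le_max_right _ _) (N + 1) ((le_max_right _ _).trans N.le_succ)
  simp only [Function.comp_apply, dist_eq_norm] at h1 h2
  set g := u (φ (ψ N))
  set k := u (φ (ψ (N + 1)))
  have hL1 : ‖L (g * k⁻¹) - 1‖ < ε / (2 * (1 + R)) := (h.norm_sub_one_mul_inv g k).trans_lt h1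
  have hgk : g * k⁻¹ = 1 := by
    refine hd _ ?_ (hL1.trans_le ?_)
    · have h3 : c (g * k⁻¹) = (c g - c k) - (L (g * k⁻¹) - 1) (c k) := by
        rw [h.cocycle_mul_inv]; simp
      have h4 : ‖(L (g * k⁻¹) - 1) (c k)‖ ≤ ε / (2 * (1 + R)) * R :=
        ((L (g * k⁻¹) - 1).le_opNorm _).trans (by gcongr; exact huR _)
      have h5 : ε / (2 * (1 + R)) * R ≤ ε / 2 := by
        rw [div_mul_eq_mul_div, div_le_div_iff₀ (by positivity) two_pos]
        nlinarith
      rw [h3]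
      linarith [norm_sub_le (c g - c k) ((L (g * k⁻¹) - 1) (c k))]
    · exact div_le_self hε.le (by linarith)
  have := hφ.injective.comp hψ.injective (hu (mul_inv_eq_one.1 hgk))
  omega

/-- By discreteness, the displacement of the origin attains its minimum on every nonempty subset. -/
theorem exists_min [FiniteDimensional ℝ V] (h : IsCrystallographic L c) {S : Set G}
    (hS : S.Nonempty) : ∃ g ∈ S, ∀ k ∈ S, ‖c g‖ ≤ ‖c k‖ := by
  obtain ⟨g₀, hg₀⟩ := hS
  obtain ⟨g, ⟨hg, hg'⟩, hmin⟩ := Set.exists_min_image (S ∩ {g | ‖c g‖ ≤ ‖c g₀‖}) (fun g => ‖c g‖)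
    ((h.finite_norm_le _).inter_of_right _) ⟨g₀, hg₀, le_refl ‖c g₀‖⟩
  refine ⟨g, hg, fun k hk => ?_⟩
  by_cases hkg : ‖c k‖ ≤ ‖c g₀‖
  · exact hmin k ⟨hk, hkg⟩
  · exact le_trans hg' (le_of_not_ge hkg)

/-- In every direction `u` there is an element that moves the origin nearly along `u` and has linear
part close to `1`. It is a quotient `γ_j γ_N⁻¹`, where `γ_k` moves the origin to within bounded
distance of `k u` and the linear parts of the `γ_k` are (by compactness) Cauchy along a
subsequence. -/
theorem exists_near_direction [FiniteDimensional ℝ V] (h : IsCrystallographic L c) (u : V)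
    {ε δ : ℝ} (hε : 0 < ε) (hδ : 0 < δ) :
    ∃ g : G, ∃ t > 0, ‖L g - 1‖ ≤ ε ∧ ‖c g - t • u‖ < δ * t := by
  obtain ⟨d, hd⟩ := h.cocompact
  choose γ hγ using fun k : ℕ => hd ((k : ℝ) • u)
  obtain ⟨φ, hφ, hL⟩ := h.exists_subseq_cauchySeq γ
  obtain ⟨N, hN⟩ := Metric.cauchySeq_iff'.1 hL _ hε
  obtain ⟨m, hm⟩ := exists_nat_gt ((d + ‖c (γ (φ N))‖) / δ)
  have hd0 : 0 ≤ d := (norm_nonneg _).trans (hγ 0)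
  have hm0 : (0 : ℝ) < m := lt_of_le_of_lt (by positivity) hm
  set j := max m N
  have hj : (m : ℝ) ≤ φ j := by exact_mod_cast (le_max_left m N).trans (hφ.id_le j)
  refine ⟨γ (φ j) * (γ (φ N))⁻¹, φ j, hm0.trans_le hj, ?_, ?_⟩
  · refine (h.norm_sub_one_mul_inv _ _).trans ?_
    rw [← dist_eq_norm]
    exact (hN j (le_max_right _ _)).le
  · rw [h.cocycle_mul_inv, sub_right_comm]
    refine (norm_sub_le _ _).trans_lt ?_
    rw [h.norm_map, norm_sub_rev]
    refine (add_le_add (hγ (φ j)) le_rfl).trans_lt ?_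
    rw [div_lt_iff₀ hδ] at hm
    nlinarith

theorem norm_commutator_sub_one_le (h : IsCrystallographic L c) (g k : G) :
    ‖L (g * k * g⁻¹ * k⁻¹) - 1‖ ≤ 2 * ‖L g - 1‖ * ‖L k - 1‖ := by
  have h0 := h.norm_sub_one_mul_inv (g * k) (k * g)
  rw [_root_.mul_inv_rev, ← mul_assoc] at h0
  refine h0.trans ?_
  have h1 : L (g * k) - L (k * g) = (L g - 1) * (L k - 1) - (L k - 1) * (L g - 1) := by
    rw [map_mul, map_mul]; noncomm_ring
  rw [h1]
  refine (norm_sub_le _ _).trans ?_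
  have h2 := norm_mul_le (L g - 1) (L k - 1)
  have h3 := norm_mul_le (L k - 1) (L g - 1)
  linarith

/-- The translational part of the commutator `[g, k]` is `(L g - 1) (c k)` up to an error that is
small when `L k` is close to `1`. -/
theorem norm_cocycle_commutator_sub_le (h : IsCrystallographic L c) (g k : G) :
    ‖c (g * k * g⁻¹ * k⁻¹) - (L g - 1) (c k)‖ ≤
      ‖L (g * k * g⁻¹ * k⁻¹) - 1‖ * ‖c k‖ + ‖L k - 1‖ * ‖c g‖ := by
  set m := g * k * g⁻¹ * k⁻¹ with hm
  have h1 : c (g * k) = c (m * (k * g)) := by rw [hm]; group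
  rw [h.cocycle g, h.cocycle m, h.cocycle k, map_add, ← mul_apply_eq_comp, ← map_mul] at h1
  have h2 : m * k = g * k * g⁻¹ := by rw [hm]; group
  have h3 : c m - (L g - 1) (c k) =
      -((L m - 1) (c k)) - (L (g * k * g⁻¹) (c g) - c g) := by
    rw [h2] at h1
    have : c m = c g + L g (c k) - (L m (c k) + L (g * k * g⁻¹) (c g)) := by
      rw [h1]; abel
    rw [this]
    simp only [_root_.sub_apply, one_apply_eq_self]
    abel
  have h4 : L (g * k * g⁻¹) (c g) - c g = L g ((L k - 1) (L g⁻¹ (c g))) := by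
    have : L g (L g⁻¹ (c g)) = c g := by
      rw [← mul_apply_eq_comp, ← map_mul]; simp
    simp [map_mul, this]
  rw [h3]
  refine (norm_sub_le _ _).trans (add_le_add ?_ ?_)
  · rw [norm_neg]; exact (L m - 1).le_opNorm _
  · rw [h4, h.norm_map]
    exact ((L k - 1).le_opNorm _).trans (by rw [h.norm_map])

/-- An element whose linear part is within `1 / 2` of the identity is a translation.

Otherwise choose such a non-translation `a` that moves the origin least. Let `F` be the fixed space
of `L a`, so that `T = L a - 1` maps `V` into `Fᗮ` and is bounded below by some `q > 0` there. Among
the `b` with `L b` very close to `1` and with the `Fᗮ`-component of `c b` longer than the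
`F`-component, choose one that moves the origin least. The commutator `[a, b]` is again such an
element, since its translational part is nearly `T (c b) ∈ Fᗮ`, and it moves the origin less, since
`‖T‖ ≤ 1 / 2`. -/
theorem map_eq_one_of_norm_sub_one_le [FiniteDimensional ℝ V] (h : IsCrystallographic L c) (g : G)
    (hg : ‖L g - 1‖ ≤ 1 / 2) : L g = 1 := by
  by_contra hg1
  obtain ⟨a, ⟨ha1, ha⟩, hamin⟩ := h.exists_min
    (S := {g | L g ≠ 1 ∧ ‖L g - 1‖ ≤ 1 / 2}) ⟨g, hg1, hg⟩
  set T : V →L[ℝ] V := L a - 1 with hT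
  set F : Submodule ℝ V := LinearMap.ker (T : V →ₗ[ℝ] V) with hF
  -- `π` projects onto `F`, and `x - π x` is the `Fᗮ`-component of `x`.
  set π : V →L[ℝ] V := F.starProjection with hπ
  have hmemF : ∀ x, x ∈ F ↔ T x = 0 := fun x => LinearMap.mem_ker
  have hπF : ∀ x, T (π x) = 0 := fun x => (hmemF _).1 (F.starProjection_apply_mem x)
  have hinner : ∀ x y, inner ℝ (L a x) (L a y) = inner ℝ x y := fun x y =>
    (LinearMap.norm_map_iff_inner_map_map (L a)).1 (h.norm_map a) x y
  have hTF : ∀ x, T x ∈ Fᗮ := fun x => by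
    rw [Submodule.mem_orthogonal]
    intro y hy
    have hy' : L a y = y := by
      have := (hmemF y).1 hy
      rwa [hT, _root_.sub_apply, one_apply_eq_self, sub_eq_zero] at this
    have h1 := hinner y x
    rw [hy'] at h1
    rw [hT, _root_.sub_apply, inner_sub_right, h1, one_apply_eq_self, sub_self]
  have hπ0 : ∀ x ∈ Fᗮ, π x = 0 := fun x hx => F.starProjection_apply_eq_zero_iff.2 hx
  have hπT : ∀ x, π (T x) = 0 := fun x => hπ0 _ (hTF x)
  have hπle : ∀ x, ‖π x‖ ≤ ‖x‖ := fun x => F.norm_starProjection_apply_le x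
  have hsub : ∀ x, x - π x ∈ Fᗮ := fun x => F.sub_starProjection_mem_orthogonal x
  have hπsub : ∀ x, ‖x - π x‖ ≤ ‖x‖ := fun x => by
    have h1 := norm_add_sq_eq_norm_sq_add_norm_sq_real
      (F.inner_right_of_mem_orthogonal (F.starProjection_apply_mem x) (hsub x))
    rw [← hπ, add_sub_cancel] at h1
    nlinarith [norm_nonneg x, norm_nonneg (x - π x), norm_nonneg (π x)]
  -- `T` is injective on `Fᗮ`, hence bounded below there.
  obtain ⟨q, hq, hqT⟩ : ∃ q > 0, ∀ x ∈ Fᗮ, q * ‖x‖ ≤ ‖T x‖ := by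
    obtain ⟨K, hK, hKT⟩ := LinearMap.exists_antilipschitzWith
      ((T : V →ₗ[ℝ] V).comp Fᗮ.subtype) (by
        rw [LinearMap.ker_eq_bot']
        intro x hx
        have hxF : (x : V) ∈ F := hx
        ext
        exact inner_self_eq_zero.1 (F.inner_right_of_mem_orthogonal hxF x.2))
    refine ⟨(K : ℝ)⁻¹, by positivity, fun x hx => ?_⟩
    have h1 := hKT.le_mul_norm (map_zero _) ⟨x, hx⟩
    rw [inv_mul_le_iff₀ (by exact_mod_cast hK)]
    exact h1
  -- `1 / 8` makes the error term less than half of `‖c b‖`; `q / 16` makes it less than half of the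
  -- lower bound `q * ‖c b - π (c b)‖` for `‖T (c b)‖`.
  set ε : ℝ := min (1 / 8) (q / 16) with hε
  have hε0 : 0 < ε := by positivity
  have hε8 : ε ≤ 1 / 8 := min_le_left _ _
  have hεq : ε ≤ q / 16 := min_le_right _ _
  have hne : {k : G | ‖L k - 1‖ ≤ ε ∧ ‖π (c k)‖ < ‖c k - π (c k)‖}.Nonempty := by
    obtain ⟨u, hu⟩ : ∃ u, T u ≠ 0 := by
      by_contra! hu
      exact ha1 (sub_eq_zero.1 (ContinuousLinearMap.ext hu))
    set w := T u
    have hw : 0 < ‖w‖ := norm_pos_iff.2 hu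
    obtain ⟨k, t, ht, hk, hkt⟩ := h.exists_near_direction w hε0 (half_pos hw)
    refine ⟨k, hk, ?_⟩
    have h1 : π (c k) = π (c k - t • w) := by simp [w, hπT]
    have h2 : t • w = (c k - π (c k)) - ((c k - t • w) - π (c k - t • w)) := by
      rw [← h1]; abel
    have h3 := norm_sub_le (c k - π (c k)) ((c k - t • w) - π (c k - t • w))
    rw [← h2, norm_smul, Real.norm_of_nonneg ht.le] at h3
    have h4 := hπsub (c k - t • w)
    have h5 := hπle (c k - t • w)
    rw [← h1] at h5
    linarith
  obtain ⟨b, ⟨hb, hbπ⟩, hbmin⟩ := h.exists_min hne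
  set m := a * b * a⁻¹ * b⁻¹ with hm
  set r := c m - T (c b) with hr
  have hb0 : 0 < ‖c b - π (c b)‖ := (norm_nonneg _).trans_lt hbπ
  have hcb : ‖c b‖ ≤ 2 * ‖c b - π (c b)‖ := by
    have := norm_add_le (c b - π (c b)) (π (c b))
    rw [sub_add_cancel] at this
    linarith
  have hcb0 : 0 < ‖c b‖ := hb0.trans_le (hπsub _)
  have hLm : ‖L m - 1‖ ≤ ‖L b - 1‖ := by
    refine (h.norm_commutator_sub_one_le a b).trans ?_
    nlinarith [norm_nonneg (L b - 1)]
  have hrle : ‖r‖ ≤ 2 * ε * ‖c b‖ := by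
    have h1 := h.norm_cocycle_commutator_sub_le a b
    rw [← hm, ← hT, ← hr] at h1
    -- If `b` is not a translation, then `‖c a‖ ≤ ‖c b‖` by the choice of `a`.
    have h2 : ‖L b - 1‖ * ‖c a‖ ≤ ε * ‖c b‖ := by
      by_cases hLb : L b = 1
      · rw [hLb, sub_self, norm_zero, zero_mul]; positivity
      · have := hamin b ⟨hLb, by linarith⟩
        gcongr
    have h3 : ‖L m - 1‖ * ‖c b‖ ≤ ε * ‖c b‖ := by gcongr; exact hLm.trans hb
    linarith
  have hcm : c m = T (c b) + r := by rw [hr]; abel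
  have hTb : q * ‖c b - π (c b)‖ ≤ ‖T (c b)‖ := by
    have := hqT _ (hsub (c b))
    rwa [map_sub, hπF, sub_zero] at this
  have hrq : 2 * ‖r‖ < q * ‖c b - π (c b)‖ := by
    have h1 : ε * ‖c b‖ ≤ q / 16 * (2 * ‖c b - π (c b)‖) := by gcongr
    nlinarith [mul_pos hq hb0]
  have hmem : ‖π (c m)‖ < ‖c m - π (c m)‖ := by
    have h1 : π (c m) = π r := by rw [hcm, map_add, hπT, zero_add]
    have h2 : T (c b) = (c m - π (c m)) - (r - π r) := by rw [h1, hcm]; abel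
    have h3 := norm_sub_le (c m - π (c m)) (r - π r)
    rw [← h2] at h3
    have h4 := hπsub r
    have h5 := hπle r
    rw [← h1] at h5
    linarith
  have h6 := hbmin m ⟨hLm.trans hb, hmem⟩
  have h7 : ‖T (c b)‖ ≤ 1 / 2 * ‖c b‖ := (T.le_opNorm _).trans (by gcongr)
  have h8 := norm_add_le (T (c b)) r
  rw [← hcm] at h8
  nlinarith

/-- Bieberbach's first theorem: the translations in a discrete cocompact group of Euclidean
isometries span the space. -/
theorem span_translations_eq_top [FiniteDimensional ℝ V] (h : IsCrystallographic L c) :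
    Submodule.span ℝ {v | ∃ g, L g = 1 ∧ c g = v} = ⊤ := by
  set W := Submodule.span ℝ {v | ∃ g, L g = 1 ∧ c g = v}
  rw [← Submodule.orthogonal_eq_bot_iff, Submodule.eq_bot_iff]
  intro u hu
  by_contra hu0
  have hu' : 0 < ‖u‖ := norm_pos_iff.2 hu0
  obtain ⟨g, t, ht, hg, hgt⟩ := h.exists_near_direction u one_half_pos hu'
  have hgW : c g ∈ W :=
    Submodule.subset_span ⟨g, h.map_eq_one_of_norm_sub_one_le g hg, rfl⟩
  have h1 : inner ℝ (t • u) (t • u - c g) = t ^ 2 * ‖u‖ ^ 2 := by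
    rw [inner_sub_right, inner_smul_left, inner_smul_left, inner_smul_right,
      Submodule.inner_left_of_mem_orthogonal hgW hu, real_inner_self_eq_norm_sq]
    simp
    ring
  have h2 := real_inner_le_norm (t • u) (t • u - c g)
  rw [h1, norm_sub_rev, norm_smul, Real.norm_of_nonneg ht.le] at h2
  nlinarith [mul_pos ht hu']

end IsCrystallographic

/-! ### Affine maps and the translation lattice of a Bieberbach group -/

namespace Aff

variable {n : ℕ}

theorem ext_lin {f g : Aff n} (hl : lin f = lin g) (h0 : f 0 = g 0) : f = g := by
  ext1 x
  rw [apply_eq f, apply_eq g, hl, h0]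

/-- The translation by a vector, as an element of `Aff(n)`. -/
def transl : Multiplicative (Fin n → ℝ) →* Aff n := AffineEquiv.constVAddHom ℝ (Fin n → ℝ)

theorem transl_apply (v : Multiplicative (Fin n → ℝ)) (x : Fin n → ℝ) :
    transl v x = v.toAdd + x := rfl

@[simp]
theorem transl_zero (v : Multiplicative (Fin n → ℝ)) : transl v 0 = v.toAdd := by
  rw [transl_apply, add_zero]

theorem lin_mulVec (f : Aff n) (x : Fin n → ℝ) :
    (lin f : Matrix (Fin n) (Fin n) ℝ) *ᵥ x = f x - f 0 := by
  rw [apply_eq f x, add_sub_cancel_right]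

@[simp]
theorem lin_transl (v : Multiplicative (Fin n → ℝ)) : lin (transl v) = 1 := by
  ext1
  refine Matrix.ext_of_mulVec_single fun i => ?_
  rw [lin_mulVec, transl_apply, transl_apply, Units.val_one, Matrix.one_mulVec]
  abel

theorem eq_transl {f : Aff n} (hf : lin f = 1) : f = transl (.ofAdd (f 0)) :=
  ext_lin (by rw [hf, lin_transl]) (by simp)

theorem mul_zero_eq (f g : Aff n) :
    (f * g) 0 = (lin f : Matrix (Fin n) (Fin n) ℝ) *ᵥ g 0 + f 0 :=
  apply_eq f (g 0)

theorem continuous_apply (f : Aff n) : Continuous f := by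
  have : (f : (Fin n → ℝ) → (Fin n → ℝ)) =
      fun x => (lin f : Matrix (Fin n) (Fin n) ℝ) *ᵥ x + f 0 := funext (apply_eq f)
  rw [this]
  fun_prop

theorem conj_transl (f : Aff n) (v : Fin n → ℝ) :
    f * transl (.ofAdd v) * f⁻¹ =
      transl (.ofAdd ((lin f : Matrix (Fin n) (Fin n) ℝ) *ᵥ v)) := by
  rw [mul_inv_eq_iff_eq_mul]
  ext1 x
  change f (v + x) = _ + f x
  rw [apply_eq f, apply_eq f x, Matrix.mulVec_add, add_assoc]
  rfl

end Aff

namespace IsBieberbach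

variable {n : ℕ} {Γ : Subgroup (Aff n)}

/-- The linear parts of the elements of `Γ`, as operators on `ℝⁿ` with its Euclidean norm. -/
noncomputable def euclideanLin (Γ : Subgroup (Aff n)) :
    Γ →* (EuclideanSpace ℝ (Fin n) →L[ℝ] EuclideanSpace ℝ (Fin n)) :=
  ((Matrix.toEuclideanCLM (n := Fin n) (𝕜 := ℝ) :
      Matrix (Fin n) (Fin n) ℝ →* _).comp (Units.coeHom _)).comp (Aff.lin.comp Γ.subtype)

theorem euclideanLin_apply (γ : Γ) (x : EuclideanSpace ℝ (Fin n)) :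
    euclideanLin Γ γ x =
      WithLp.toLp 2 ((Aff.lin (γ : Aff n) : Matrix (Fin n) (Fin n) ℝ) *ᵥ x.ofLp) := rfl

theorem transpose_mul_lin (h : IsBieberbach Γ) (γ : Γ) :
    (Aff.lin (γ : Aff n) : Matrix (Fin n) (Fin n) ℝ)ᵀ *
      (Aff.lin (γ : Aff n) : Matrix (Fin n) (Fin n) ℝ) = 1 := by
  have : (Aff.lin (γ : Aff n) : Matrix (Fin n) (Fin n) ℝ)ᵀ * 1 *
    (Aff.lin (γ : Aff n) : Matrix (Fin n) (Fin n) ℝ) = 1 := h.le_euc γ.2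
  rwa [Matrix.mul_one] at this

theorem inv_lin (h : IsBieberbach Γ) (γ : Γ) :
    ((Aff.lin (γ : Aff n))⁻¹ : GL (Fin n) ℝ).1 =
      (Aff.lin (γ : Aff n) : Matrix (Fin n) (Fin n) ℝ)ᵀ := by
  rw [Matrix.coe_units_inv]
  exact Matrix.inv_eq_left_inv (h.transpose_mul_lin γ)

/-- The topology of `Γ` is induced by the pair of translational and linear part, where the latter
ranges over a normed space of operators. (The topology of `GL(n, ℝ)` also involves the inverse, but
on orthogonal matrices that is the transpose.) -/
theorem isInducing (h : IsBieberbach Γ) : Topology.IsInducing fun γ : Γ =>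
    (WithLp.toLp 2 ((γ : Aff n) 0), euclideanLin Γ γ) := by
  have hE : Topology.IsInducing fun γ : Γ =>
      ((γ : Aff n) 0, Units.embedProduct _ (Aff.lin (γ : Aff n))) :=
    (Topology.IsInducing.id.prodMap Units.isInducing_embedProduct).comp
      ((Topology.IsInducing.mk rfl : Topology.IsInducing fun f : Aff n => (f 0, Aff.lin f)).comp
        Topology.IsInducing.subtypeVal)
  let T := (Matrix.toEuclideanCLM (n := Fin n) (𝕜 := ℝ)).toAlgEquiv.toLinearEquiv
  have hT : Continuous T := LinearMap.continuous_of_finiteDimensional T.toLinearMap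
  have hT' : Continuous T.symm := LinearMap.continuous_of_finiteDimensional T.symm.toLinearMap
  let F : EuclideanSpace ℝ (Fin n) × (EuclideanSpace ℝ (Fin n) →L[ℝ] EuclideanSpace ℝ (Fin n)) →
      (Fin n → ℝ) × (Matrix (Fin n) (Fin n) ℝ × (Matrix (Fin n) (Fin n) ℝ)ᵐᵒᵖ) :=
    fun p => (p.1.ofLp, (T.symm p.2, .op (T.symm p.2)ᵀ))
  refine Topology.IsInducing.of_comp (g := F) ?_ ?_ ?_
  · refine Continuous.prodMk ?_ ?_
    · exact (PiLp.continuous_toLp 2 _).comp (continuous_fst.comp hE.continuous)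
    · exact hT.comp (continuous_fst.comp (continuous_snd.comp hE.continuous))
  · refine Continuous.prodMk ((PiLp.continuous_ofLp 2 _).comp continuous_fst) ?_
    refine Continuous.prodMk (hT'.comp continuous_snd) ?_
    exact MulOpposite.continuous_op.comp (hT'.comp continuous_snd).matrix_transpose
  · convert hE using 2 with γ
    have h1 : T.symm (euclideanLin Γ γ) = (Aff.lin (γ : Aff n) : Matrix (Fin n) (Fin n) ℝ) :=
      T.symm_apply_apply _
    simp only [F, Function.comp_apply, h1, Units.embedProduct_apply, h.inv_lin]

theorem norm_euclideanLin_apply (h : IsBieberbach Γ) (γ : Γ) (x : EuclideanSpace ℝ (Fin n)) :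
    ‖euclideanLin Γ γ x‖ = ‖x‖ := by
  rw [← sq_eq_sq₀ (norm_nonneg _) (norm_nonneg _), euclideanLin_apply,
    EuclideanSpace.real_norm_sq_eq, EuclideanSpace.real_norm_sq_eq]
  have h1 := congrArg (fun M => x.ofLp ⬝ᵥ M *ᵥ x.ofLp) (h.transpose_mul_lin γ)
  simp only [← Matrix.mulVec_mulVec, Matrix.one_mulVec] at h1
  rw [Matrix.dotProduct_mulVec, Matrix.vecMul_transpose] at h1
  simp only [dotProduct, ← pow_two] at h1
  exact h1

/-- As `ℝⁿ / Γ` is compact, it is covered by the image of one ball. -/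
theorem exists_dist_le (h : IsBieberbach Γ) :
    ∃ d, ∀ x, ∃ γ : Γ, ‖x - WithLp.toLp 2 ((γ : Aff n) 0)‖ ≤ d := by
  have := h.compact_quotient
  have : ContinuousConstSMul Γ (Fin n → ℝ) := ⟨fun γ => Aff.continuous_apply (γ : Aff n)⟩
  let π : (Fin n → ℝ) → Quotient (MulAction.orbitRel Γ (Fin n → ℝ)) := Quotient.mk _
  have hπ : IsOpenMap π := isOpenMap_quotient_mk'_mul
  let U : ℕ → Set (Fin n → ℝ) := fun k => {x | ‖WithLp.toLp 2 x‖ < k}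
  have hU : ∀ k, IsOpen (U k) := fun k =>
    isOpen_lt (PiLp.continuous_toLp 2 _).norm continuous_const
  obtain ⟨k, hk⟩ := isCompact_univ.elim_directed_cover (fun k => π '' U k) (fun k => hπ _ (hU k))
    (fun q _ => by
      obtain ⟨x, rfl⟩ := Quotient.exists_rep q
      obtain ⟨k, hk⟩ := exists_nat_gt ‖WithLp.toLp 2 x‖
      exact Set.mem_iUnion.2 ⟨k, x, hk, rfl⟩)
    (directed_of_isDirected_le fun i j hij => Set.image_mono fun x hx =>
      lt_of_lt_of_le (b := (i : ℝ)) hx (by exact_mod_cast hij))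
  refine ⟨k, fun x => ?_⟩
  obtain ⟨y, hy, hyx⟩ := hk (Set.mem_univ (π x.ofLp))
  obtain ⟨γ, hγ⟩ := Quotient.exact hyx
  refine ⟨γ⁻¹, ?_⟩
  have hx : x = WithLp.toLp 2 (((γ⁻¹ : Γ) : Aff n) y) := by
    rw [← hγ]
    exact congrArg (WithLp.toLp 2) (inv_smul_smul γ x.ofLp).symm
  have h1 : x - WithLp.toLp 2 (((γ⁻¹ : Γ) : Aff n) 0) =
      euclideanLin Γ γ⁻¹ (WithLp.toLp 2 y) := by
    rw [hx, euclideanLin_apply, Aff.lin_mulVec, WithLp.toLp_sub]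
  rw [h1, h.norm_euclideanLin_apply]
  exact le_of_lt hy

theorem isCrystallographic (h : IsBieberbach Γ) :
    IsCrystallographic (euclideanLin Γ) fun γ => WithLp.toLp 2 ((γ : Aff n) 0) where
  norm_map := h.norm_euclideanLin_apply
  cocycle γ δ := by
    rw [euclideanLin_apply, ← WithLp.toLp_add, Subgroup.coe_mul, Aff.mul_zero_eq, add_comm]
  discrete := by
    have := h.discrete
    have h1 : ({1} : Set Γ) ∈ nhds 1 := by simp
    rw [h.isInducing.nhds_eq_comap] at h1
    obtain ⟨ε, hε, h2⟩ := (Metric.nhds_basis_ball.comap _).mem_iff.1 h1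
    refine ⟨ε, hε, fun γ hc hL => h2 ?_⟩
    rw [Set.mem_preimage, mem_ball_iff_norm, Prod.norm_def, max_lt_iff]
    refine ⟨?_, ?_⟩
    · simpa using hc
    · simpa using hL
  cocompact := h.exists_dist_le

/-- The group of all `v ∈ ℝⁿ` such that the translation by `v` lies in `Γ`. -/
def translationLattice (Γ : Subgroup (Aff n)) : Submodule ℤ (Fin n → ℝ) :=
  AddSubgroup.toIntSubmodule
    { carrier := {v | Aff.transl (.ofAdd v) ∈ Γ}
      zero_mem' := by simp
      add_mem' := fun hv hw => by
        rw [Set.mem_ofPred_eq, ofAdd_add, map_mul]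
        exact mul_mem hv hw
      neg_mem' := fun hv => by
        rw [Set.mem_ofPred_eq, ofAdd_neg, map_inv]
        exact inv_mem hv }

theorem mem_translationLattice {v : Fin n → ℝ} :
    v ∈ translationLattice Γ ↔ Aff.transl (.ofAdd v) ∈ Γ := Iff.rfl

theorem euclideanLin_eq_one_iff {γ : Γ} :
    euclideanLin Γ γ = 1 ↔ Aff.lin (γ : Aff n) = 1 := by
  rw [← Units.val_eq_one]
  exact map_eq_one_iff (Matrix.toEuclideanCLM (n := Fin n) (𝕜 := ℝ))
    (Matrix.toEuclideanCLM (n := Fin n) (𝕜 := ℝ)).injective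

theorem discreteTopology_translationLattice (h : IsBieberbach Γ) :
    DiscreteTopology (translationLattice Γ) := by
  obtain ⟨ε, hε, hd⟩ := h.isCrystallographic.discrete
  have : IsOpen
      ((fun v : translationLattice Γ => ‖WithLp.toLp 2 (v : Fin n → ℝ)‖) ⁻¹' Set.Iio ε) :=
    isOpen_Iio.preimage ((PiLp.continuous_toLp 2 _).comp continuous_subtype_val).norm
  refine discreteTopology_of_isOpen_singleton_zero ?_
  convert this
  ext v
  simp only [Set.mem_singleton_iff, Set.mem_preimage, Set.mem_Iio]
  refine ⟨fun hv => by simpa [hv] using hε, fun hv => ?_⟩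
  have h1 : euclideanLin Γ ⟨_, v.2⟩ = 1 := euclideanLin_eq_one_iff.2 (Aff.lin_transl _)
  have h2 := hd ⟨_, v.2⟩ (by simpa using hv) (by rw [h1]; simpa using hε)
  have h3 := congrArg (fun γ : Γ => (γ : Aff n) 0) h2
  ext1
  simpa using h3

theorem span_translationLattice (h : IsBieberbach Γ) :
    Submodule.span ℝ (translationLattice Γ : Set (Fin n → ℝ)) = ⊤ := by
  have h1 := congrArg (Submodule.map (WithLp.linearEquiv 2 ℝ (Fin n → ℝ)).toLinearMap)
    h.isCrystallographic.span_translations_eq_top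
  rw [Submodule.map_span, Submodule.map_top, LinearEquiv.range] at h1
  rw [← h1]
  congr 1
  ext v
  rw [SetLike.mem_coe, mem_translationLattice]
  constructor
  · intro hv
    exact ⟨_, ⟨⟨_, hv⟩, euclideanLin_eq_one_iff.2 (Aff.lin_transl _), rfl⟩, by simp⟩
  · rintro ⟨_, ⟨γ, hγ, rfl⟩, rfl⟩
    have := Aff.eq_transl (euclideanLin_eq_one_iff.1 hγ)
    simp [← this]

/-- The translations in a Bieberbach group are those by the vectors of a lattice `P ℤⁿ`. -/
theorem exists_lattice_basis (h : IsBieberbach Γ) :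
    ∃ P : GL (Fin n) ℝ, ∀ v : Fin n → ℝ, Aff.transl (.ofAdd v) ∈ Γ ↔
      ∃ z : Fin n → ℤ, v = (P : Matrix (Fin n) (Fin n) ℝ) *ᵥ fun i => (z i : ℝ) := by
  have := h.discreteTopology_translationLattice
  have : IsZLattice ℝ (translationLattice Γ) := ⟨h.span_translationLattice⟩
  let b := (IsZLattice.basis (translationLattice Γ)).ofZLatticeBasis ℝ
  let e := Pi.basisFun ℝ (Fin n)
  refine ⟨⟨e.toMatrix b, b.toMatrix e, e.toMatrix_mul_toMatrix_flip b,
    b.toMatrix_mul_toMatrix_flip e⟩, fun v => ?_⟩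
  rw [← mem_translationLattice,
    ← (IsZLattice.basis (translationLattice Γ)).ofZLatticeBasis_span ℝ,
    Submodule.mem_span_range_iff_exists_fun]
  refine exists_congr fun z => ?_
  rw [eq_comm]
  congr! 1
  ext i
  simp [Matrix.mulVec, dotProduct, Module.Basis.toMatrix_apply, e, b, mul_comm]

end IsBieberbach

/-! ### Density of rational matrices, and the groups `O(B)` -/

namespace Matrix

variable {n : ℕ}

/-- `GL(n, ℝ)` is an open subspace of the space of all matrices. -/
theorem isOpenEmbedding_coe_GL :
    Topology.IsOpenEmbedding (Units.val : GL (Fin n) ℝ → Matrix (Fin n) (Fin n) ℝ) := by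
  -- Any submultiplicative norm will do; the statement only depends on the topology.
  let : NormedRing (Matrix (Fin n) (Fin n) ℝ) := Matrix.linftyOpNormedRing
  let : NormedSpace ℝ (Matrix (Fin n) (Fin n) ℝ) := Matrix.linftyOpNormedSpace
  have : CompleteSpace (Matrix (Fin n) (Fin n) ℝ) := FiniteDimensional.complete ℝ _
  exact Units.isOpenEmbedding_val

theorem denseRange_GL_rat :
    DenseRange (GeneralLinearGroup.map (n := Fin n) (Rat.castHom ℝ)) := by
  have h1 : DenseRange fun A : Matrix (Fin n) (Fin n) ℚ => A.map (Rat.castHom ℝ) :=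
    DenseRange.piMap fun _ => DenseRange.piMap fun _ => Rat.denseRange_cast
  refine dense_iff_inter_open.2 fun V hV ⟨X, hX⟩ => ?_
  obtain ⟨_, ⟨Y, hYV, hY⟩, A, rfl⟩ := dense_iff_inter_open.1 h1 _
    (isOpenEmbedding_coe_GL.isOpenMap V hV) ⟨X, X, hX, rfl⟩
  have hA : IsUnit A := by
    rw [Matrix.isUnit_iff_isUnit_det, isUnit_iff_ne_zero]
    intro h0
    have h2 : (Y : Matrix (Fin n) (Fin n) ℝ).det = 0 := by
      rw [hY]
      change (A.map (Rat.castHom ℝ)).det = 0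
      rw [← RingHom.mapMatrix_apply, ← RingHom.map_det, h0, map_zero]
    exact (Matrix.isUnits_det_units Y).ne_zero h2
  obtain ⟨R, rfl⟩ := hA
  refine ⟨_, hYV, R, ?_⟩
  ext1
  exact hY.symm

open scoped MatrixOrder in
theorem PosDef.exists_eq_transpose_mul_self {B : Matrix (Fin n) (Fin n) ℝ} (hB : B.PosDef) :
    ∃ S : GL (Fin n) ℝ, B = (S : Matrix (Fin n) (Fin n) ℝ)ᵀ * (S : Matrix (Fin n) (Fin n) ℝ) := by
  obtain ⟨S, hS⟩ := CStarAlgebra.nonneg_iff_eq_star_mul_self.mp hB.posSemidef.nonneg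
  rw [Matrix.star_eq_conjTranspose, Matrix.conjTranspose_eq_transpose_of_trivial] at hS
  obtain ⟨T, rfl⟩ : IsUnit S := by
    have := hB.isUnit
    rw [hS, Matrix.isUnit_iff_isUnit_det, Matrix.det_mul] at this
    exact (Matrix.isUnit_iff_isUnit_det _).2 (isUnit_of_mul_isUnit_right this)
  exact ⟨T, hS⟩

theorem isCompact_setOf_transpose_mul_self :
    IsCompact {U : Matrix (Fin n) (Fin n) ℝ | Uᵀ * U = 1} := by
  have h1 : IsCompact
      (Set.univ.pi fun _ : Fin n => Set.univ.pi fun _ : Fin n => Set.Icc (-1 : ℝ) 1) :=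
    isCompact_univ_pi fun _ => isCompact_univ_pi fun _ => isCompact_Icc
  refine h1.of_isClosed_subset (isClosed_eq (by fun_prop) continuous_const) fun U hU i _ j _ => ?_
  have := entry_norm_bound_of_unitary (𝕜 := ℝ) (U := U) (Matrix.mem_unitaryGroup_iff'.2 hU) i j
  exact abs_le.1 this

/-- If `M` preserves `B` (that is, `Mᵀ B M = B`), then, with `T = R⁻¹`, the conjugate `R M T`
preserves the transported form `Tᵀ B T`. -/
theorem transpose_conj_mul_conj {R T : Matrix (Fin n) (Fin n) ℝ} (h : T * R = 1)
    (B M : Matrix (Fin n) (Fin n) ℝ) :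
    (R * M * T)ᵀ * (Tᵀ * B * T) * (R * M * T) = Tᵀ * (Mᵀ * B * M) * T := by
  calc (R * M * T)ᵀ * (Tᵀ * B * T) * (R * M * T)
      = Tᵀ * (Mᵀ * ((T * R)ᵀ * B * (T * R)) * M) * T := by
        simp only [Matrix.transpose_mul, Matrix.mul_assoc]
    _ = Tᵀ * (Mᵀ * B * M) * T := by
        rw [h, Matrix.transpose_one, Matrix.one_mul, Matrix.mul_one]

theorem PosDef.isCompact_isometries {B : Matrix (Fin n) (Fin n) ℝ} (hB : B.PosDef) :
    IsCompact {M : Matrix (Fin n) (Fin n) ℝ | Mᵀ * B * M = B} := by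
  obtain ⟨S, rfl⟩ := hB.exists_eq_transpose_mul_self
  obtain ⟨S, T, hST, hTS⟩ := S
  change IsCompact {M : Matrix (Fin n) (Fin n) ℝ | Mᵀ * (Sᵀ * S) * M = Sᵀ * S}
  have h1 := isCompact_setOf_transpose_mul_self.image
    (f := fun U : Matrix (Fin n) (Fin n) ℝ => T * U * S) (by fun_prop)
  convert h1
  ext M
  constructor
  · intro hM
    refine ⟨S * M * T, ?_, ?_⟩
    · have h2 := transpose_conj_mul_conj hTS (Sᵀ * S) M
      have h3 : Tᵀ * (Sᵀ * S) * T = 1 := by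
        rw [← Matrix.mul_assoc, ← Matrix.transpose_mul, hST, Matrix.transpose_one,
          Matrix.one_mul, hST]
      rwa [hM, h3, Matrix.mul_one] at h2
    · change T * (S * M * T) * S = M
      rw [Matrix.mul_assoc S, ← Matrix.mul_assoc T, hTS, Matrix.one_mul, Matrix.mul_assoc, hTS,
        Matrix.mul_one]
  · rintro ⟨U, hU, rfl⟩
    have h2 := transpose_conj_mul_conj hST 1 U
    rw [Matrix.mul_one, Matrix.mul_one, hU, Matrix.mul_one] at h2
    exact h2

theorem PosDef.finite_integral_isometries {B : Matrix (Fin n) (Fin n) ℝ} (hB : B.PosDef) :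
    {A : GL (Fin n) ℝ | A ∈ formGroup B ∧
      A ∈ (GeneralLinearGroup.map (n := Fin n) (Int.castRingHom ℝ)).range}.Finite := by
  have hbd : Bornology.IsBounded (α := Fin n → Fin n → ℝ)
    {M : Matrix (Fin n) (Fin n) ℝ | Mᵀ * B * M = B} := hB.isCompact_isometries.isBounded
  obtain ⟨r, hr⟩ := hbd.exists_norm_le
  have hfin : {Z : Matrix (Fin n) (Fin n) ℤ | ∀ i j, Z i j ∈ Set.Icc (-⌈r⌉) ⌈r⌉}.Finite :=
    Set.Finite.pi' fun _ => Set.Finite.pi' fun _ => Set.finite_Icc _ _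
  refine Set.Finite.of_finite_image (f := Units.val) ((hfin.image
    fun Z : Matrix (Fin n) (Fin n) ℤ => Z.map (Int.castRingHom ℝ)).subset ?_)
    Units.val_injective.injOn
  rintro _ ⟨_, ⟨hA, Z, rfl⟩, rfl⟩
  refine ⟨Z, fun i j => ?_, rfl⟩
  have h1 : |((Z : Matrix (Fin n) (Fin n) ℤ) i j : ℝ)| ≤ r :=
    (norm_le_pi_norm _ j).trans ((norm_le_pi_norm _ i).trans (hr _ hA))
  have h2 := abs_le.1 (h1.trans (Int.le_ceil r))
  exact ⟨by exact_mod_cast h2.1, by exact_mod_cast h2.2⟩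

theorem PosDef.isCompact_formGroup {B : Matrix (Fin n) (Fin n) ℝ} (hB : B.PosDef) :
    IsCompact (formGroup B : Set (GL (Fin n) ℝ)) := by
  let S : Submonoid (Matrix (Fin n) (Fin n) ℝ) :=
    { carrier := {M | Mᵀ * B * M = B}
      one_mem' := by simp
      mul_mem' := fun {M N} hM hN => by
        simp only [Set.mem_ofPred_eq] at hM hN ⊢
        calc (M * N)ᵀ * B * (M * N) = Nᵀ * (Mᵀ * B * M) * N := by
              simp only [Matrix.transpose_mul, Matrix.mul_assoc]
          _ = B := by rw [hM, hN] }
  have h1 : IsCompact (S.units : Set (GL (Fin n) ℝ)) :=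
    Submonoid.units_isCompact hB.isCompact_isometries
  convert h1
  ext A
  exact ⟨fun hA => ⟨hA, (formGroup B).inv_mem hA⟩, fun hA => hA.1⟩

theorem PosDef.dotProduct_mulVec_comm {B : Matrix (Fin n) (Fin n) ℝ} (hB : B.PosDef)
    (x y : Fin n → ℝ) : x ⬝ᵥ B *ᵥ y = y ⬝ᵥ B *ᵥ x := by
  have h1 : Bᵀ = B := by
    rw [← Matrix.conjTranspose_eq_transpose_of_trivial]; exact hB.isHermitian
  rw [Matrix.dotProduct_mulVec, dotProduct_comm, ← Matrix.mulVec_transpose, h1]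

theorem PosDef.dotProduct_pos {B : Matrix (Fin n) (Fin n) ℝ} (hB : B.PosDef) {x : Fin n → ℝ}
    (hx : x ≠ 0) : 0 < x ⬝ᵥ B *ᵥ x := by
  simpa using hB.dotProduct_mulVec_pos hx

theorem PosDef.mem_formGroup_of_forall {B : Matrix (Fin n) (Fin n) ℝ} (hB : B.PosDef)
    {A : GL (Fin n) ℝ} (h : ∀ x : Fin n → ℝ,
      ((A : Matrix (Fin n) (Fin n) ℝ) *ᵥ x) ⬝ᵥ B *ᵥ ((A : Matrix (Fin n) (Fin n) ℝ) *ᵥ x) =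
        x ⬝ᵥ B *ᵥ x) : A ∈ formGroup B := by
  have h1 : ∀ x y : Fin n → ℝ,
      ((A : Matrix (Fin n) (Fin n) ℝ) *ᵥ x) ⬝ᵥ B *ᵥ ((A : Matrix (Fin n) (Fin n) ℝ) *ᵥ y) =
        x ⬝ᵥ B *ᵥ y := fun x y => by
    have h2 := h (x + y)
    simp only [Matrix.mulVec_add, dotProduct_add, add_dotProduct] at h2
    have h3 := hB.dotProduct_mulVec_comm x y
    have h4 := hB.dotProduct_mulVec_comm ((A : Matrix (Fin n) (Fin n) ℝ) *ᵥ x)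
      ((A : Matrix (Fin n) (Fin n) ℝ) *ᵥ y)
    linarith [h x, h y]
  change (A : Matrix (Fin n) (Fin n) ℝ)ᵀ * B * (A : Matrix (Fin n) (Fin n) ℝ) = B
  ext i j
  have h5 := h1 (Pi.single i 1) (Pi.single j 1)
  rw [← Matrix.vecMul_transpose, ← Matrix.dotProduct_mulVec, Matrix.mulVec_mulVec,
    Matrix.mulVec_mulVec] at h5
  simpa using h5

/-- `O(B)` acts transitively on the spheres of `B`. -/
theorem PosDef.exists_mem_formGroup_mulVec_eq {B : Matrix (Fin n) (Fin n) ℝ} (hB : B.PosDef)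
    {x y : Fin n → ℝ} (h : x ⬝ᵥ B *ᵥ x = y ⬝ᵥ B *ᵥ y) :
    ∃ U ∈ formGroup B, (U : Matrix (Fin n) (Fin n) ℝ) *ᵥ x = y := by
  by_cases hxy : x = y
  · exact ⟨1, one_mem _, by simp [hxy]⟩
  obtain ⟨w, hw⟩ : ∃ w, w = x - y := ⟨_, rfl⟩
  have hw0 : 0 < w ⬝ᵥ B *ᵥ w := hB.dotProduct_pos (hw ▸ sub_ne_zero.2 hxy)
  set M : Matrix (Fin n) (Fin n) ℝ := 1 - (2 / (w ⬝ᵥ B *ᵥ w)) • vecMulVec w (B *ᵥ w) with hM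
  have hMv : ∀ v, M *ᵥ v = v - (2 * (v ⬝ᵥ B *ᵥ w) / (w ⬝ᵥ B *ᵥ w)) • w := fun v => by
    rw [hM, Matrix.sub_mulVec, Matrix.one_mulVec, Matrix.smul_mulVec, Matrix.vecMulVec_mulVec]
    ext i
    simp [dotProduct_comm v]
    ring
  have hMM : M * M = 1 := by
    have h1 : ∀ v, M *ᵥ (M *ᵥ v) = v := fun v => by
      rw [hMv (M *ᵥ _), hMv, sub_dotProduct, smul_dotProduct, smul_eq_mul,
        div_mul_cancel₀ _ hw0.ne', sub_sub, ← add_smul, ← add_div,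
        show 2 * (v ⬝ᵥ B *ᵥ w) + 2 * (v ⬝ᵥ B *ᵥ w - 2 * (v ⬝ᵥ B *ᵥ w)) = 0 by ring, zero_div,
        zero_smul, sub_zero]
    refine Matrix.ext_of_mulVec_single fun i => ?_
    rw [← Matrix.mulVec_mulVec, h1, Matrix.one_mulVec]
  -- `M` is the `B`-orthogonal reflection that exchanges `x` and `y`.
  refine ⟨⟨M, M, hMM, hMM⟩, hB.mem_formGroup_of_forall fun v => ?_, ?_⟩
  · change (M *ᵥ v) ⬝ᵥ B *ᵥ (M *ᵥ v) = v ⬝ᵥ B *ᵥ v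
    rw [hMv]
    simp only [Matrix.mulVec_sub, Matrix.mulVec_smul, dotProduct_sub, sub_dotProduct,
      smul_dotProduct, dotProduct_smul, smul_eq_mul, hB.dotProduct_mulVec_comm w v]
    field_simp
    ring
  · change M *ᵥ x = y
    have h1 : 2 * (x ⬝ᵥ B *ᵥ w) = w ⬝ᵥ B *ᵥ w := by
      have := hB.dotProduct_mulVec_comm x y
      simp only [hw, Matrix.mulVec_sub, dotProduct_sub, sub_dotProduct]
      linarith
    rw [hMv, h1, div_self hw0.ne', one_smul, hw, sub_sub_cancel]

theorem pow_mulVec_eq {A : Matrix (Fin n) (Fin n) ℝ} {c : ℝ} {e : Fin n → ℝ}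
    (h : A *ᵥ e = c • e) (k : ℕ) : (A ^ k) *ᵥ e = c ^ k • e := by
  induction k with
  | zero => simp
  | succ k ih =>
    rw [pow_succ, ← Matrix.mulVec_mulVec, h, Matrix.mulVec_smul, ih, smul_smul, pow_succ']

/-- An eigenvalue of an element of a compact matrix group has absolute value at most `1`, as the
powers of the element stay bounded. -/
theorem abs_le_one_of_mem_compact {L : Subgroup (GL (Fin n) ℝ)}
    (hL : IsCompact (L : Set (GL (Fin n) ℝ))) {A : GL (Fin n) ℝ} (hA : A ∈ L) {c : ℝ}
    {e : Fin n → ℝ} (he : e ≠ 0) (h : (A : Matrix (Fin n) (Fin n) ℝ) *ᵥ e = c • e) : |c| ≤ 1 := by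
  have h1 : Continuous fun X : GL (Fin n) ℝ => (X : Matrix (Fin n) (Fin n) ℝ) *ᵥ e :=
    Units.continuous_val.matrix_mulVec continuous_const
  obtain ⟨r, hr⟩ := hL.exists_bound_of_continuousOn h1.continuousOn
  by_contra! hc
  have he' : 0 < ‖e‖ := norm_pos_iff.2 he
  obtain ⟨k, hk⟩ := pow_unbounded_of_one_lt (r / ‖e‖) hc
  have h2 := hr (A ^ k) (pow_mem hA k)
  rw [Units.val_pow_eq_pow_val, pow_mulVec_eq h, norm_smul, norm_pow, Real.norm_eq_abs] at h2
  rw [div_lt_iff₀ he'] at hk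
  linarith

/-- `O(B)` is a maximal compact subgroup. If a compact group `L ≥ O(B)` contained some `A` that
changes the `B`-length of a vector `e`, then, `O(B)` being transitive on spheres, some `U ∈ O(B)`
would move `A e` to `c • e` with `c > 0` and `c ≠ 1`, and the powers of `U A ∈ L` or of its inverse
would be unbounded. -/
theorem PosDef.isMaximalCompact_formGroup {B : Matrix (Fin n) (Fin n) ℝ} (hB : B.PosDef) :
    IsMaximalCompact (formGroup B) := by
  refine ⟨hB.isCompact_formGroup, fun L hL hBL A hA => hB.mem_formGroup_of_forall fun e => ?_⟩
  by_cases he : e = 0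
  · simp [he]
  set y := (A : Matrix (Fin n) (Fin n) ℝ) *ᵥ e with hy
  have hy0 : y ≠ 0 := fun h0 => he <| by
    have : ((A⁻¹ : GL (Fin n) ℝ) : Matrix (Fin n) (Fin n) ℝ) *ᵥ y = e := by
      rw [hy, Matrix.mulVec_mulVec, Units.inv_mul, Matrix.one_mulVec]
    rw [← this, h0, Matrix.mulVec_zero]
  have hqe := hB.dotProduct_pos he
  have hqy := hB.dotProduct_pos hy0
  set c := √((y ⬝ᵥ B *ᵥ y) / (e ⬝ᵥ B *ᵥ e)) with hc
  have hc0 : 0 < c := Real.sqrt_pos.2 (div_pos hqy hqe)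
  have hc2 : c ^ 2 = (y ⬝ᵥ B *ᵥ y) / (e ⬝ᵥ B *ᵥ e) := Real.sq_sqrt (div_pos hqy hqe).le
  obtain ⟨U, hU, hUy⟩ := hB.exists_mem_formGroup_mulVec_eq (x := y) (y := c • e) (by
    rw [Matrix.mulVec_smul, smul_dotProduct, dotProduct_smul, smul_eq_mul, smul_eq_mul,
      ← mul_assoc, ← pow_two, hc2, div_mul_cancel₀ _ hqe.ne'])
  have hUA : U * A ∈ L := mul_mem (hBL hU) hA
  have h1 : ((U * A : GL (Fin n) ℝ) : Matrix (Fin n) (Fin n) ℝ) *ᵥ e = c • e := by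
    rw [Units.val_mul, ← Matrix.mulVec_mulVec, ← hy, hUy]
  have h2 : (((U * A)⁻¹ : GL (Fin n) ℝ) : Matrix (Fin n) (Fin n) ℝ) *ᵥ e = c⁻¹ • e := by
    have h3 : e = c⁻¹ • (((U * A : GL (Fin n) ℝ) : Matrix (Fin n) (Fin n) ℝ) *ᵥ e) := by
      rw [h1, smul_smul, inv_mul_cancel₀ hc0.ne', one_smul]
    conv_lhs => rw [h3]
    rw [Matrix.mulVec_smul, Matrix.mulVec_mulVec, Units.inv_mul, Matrix.one_mulVec]
  have h3 := abs_le_one_of_mem_compact hL hUA he h1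
  have h4 := abs_le_one_of_mem_compact hL (inv_mem hUA) he h2
  rw [abs_of_pos hc0] at h3
  rw [abs_of_pos (inv_pos.2 hc0)] at h4
  have h5 : c = 1 := le_antisymm h3 ((inv_le_one₀ hc0).1 h4)
  rw [h5, one_pow, eq_comm, div_eq_one_iff_eq hqe.ne'] at hc2
  exact hc2

end Matrix

/-! ### Conjugation and finite index in the affine group -/

theorem Subgroup.map_conj_map_conj {G : Type*} [Group G] (H : Subgroup G) (a b : G) :
    (H.map (MulAut.conj a).toMonoidHom).map (MulAut.conj b).toMonoidHom =
      H.map (MulAut.conj (b * a)).toMonoidHom := by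
  rw [Subgroup.map_map, map_mul]
  rfl

namespace Aff

variable {n : ℕ}

/-- The linear map with matrix `X`, as an element of `Aff(n)`. -/
noncomputable def ofGL (X : GL (Fin n) ℝ) : Aff n :=
  (LinearMap.GeneralLinearGroup.generalLinearEquiv ℝ (Fin n → ℝ)
    (Matrix.GeneralLinearGroup.toLin X)).toAffineEquiv

theorem ofGL_apply (X : GL (Fin n) ℝ) (v : Fin n → ℝ) :
    ofGL X v = (X : Matrix (Fin n) (Fin n) ℝ) *ᵥ v := rfl

@[simp]
theorem ofGL_zero (X : GL (Fin n) ℝ) : ofGL X 0 = 0 := by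
  rw [ofGL_apply, Matrix.mulVec_zero]

@[simp]
theorem lin_ofGL (X : GL (Fin n) ℝ) : lin (ofGL X) = X :=
  MulEquiv.symm_apply_apply (Matrix.GeneralLinearGroup.toLin.trans
    (LinearMap.GeneralLinearGroup.generalLinearEquiv ℝ (Fin n → ℝ))) X

theorem conj_ofGL_zero (X : GL (Fin n) ℝ) (f : Aff n) :
    (ofGL X * f * (ofGL X)⁻¹) 0 = (X : Matrix (Fin n) (Fin n) ℝ) *ᵥ f 0 := by
  have h : (ofGL X)⁻¹ 0 = 0 := by
    have := (ofGL X).symm_apply_apply 0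
    rwa [ofGL_zero] at this
  rw [AffineEquiv.coe_mul, AffineEquiv.coe_mul, Function.comp_apply, h, Function.comp_apply,
    ofGL_apply]

theorem transl_mem_map_conj_iff {Γ : Subgroup (Aff n)} {x : Aff n} {v : Fin n → ℝ} :
    transl (.ofAdd v) ∈ Γ.map (MulAut.conj x).toMonoidHom ↔
      transl (.ofAdd (((lin x)⁻¹ : GL (Fin n) ℝ).1 *ᵥ v)) ∈ Γ := by
  rw [← map_inv, ← conj_transl]
  constructor
  · rintro ⟨γ, hγ, h⟩
    rw [← h]
    convert hγ using 1
    simp [mul_assoc]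
  · intro h
    refine ⟨_, h, ?_⟩
    simp [mul_assoc]

theorem map_conj_le_orthogonalAffine {Γ : Subgroup (Aff n)} {B : Matrix (Fin n) (Fin n) ℝ}
    (h : Γ ≤ orthogonalAffine (formGroup B)) (x : Aff n) :
    Γ.map (MulAut.conj x).toMonoidHom ≤ orthogonalAffine (formGroup
      (((lin x)⁻¹ : GL (Fin n) ℝ).1ᵀ * B * ((lin x)⁻¹ : GL (Fin n) ℝ).1)) := by
  rintro _ ⟨γ, hγ, rfl⟩
  have h1 : (lin γ : Matrix (Fin n) (Fin n) ℝ)ᵀ * B * (lin γ : Matrix (Fin n) (Fin n) ℝ) = B :=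
    h hγ
  have h2 := transpose_conj_mul_conj (Units.inv_mul (lin x)) B (lin γ : Matrix (Fin n) (Fin n) ℝ)
  rw [h1] at h2
  change lin (x * γ * x⁻¹) ∈ formGroup _
  rw [map_mul, map_mul, map_inv]
  exact h2

/-- The homomorphism that sends `z ∈ ℤⁿ` to the translation by `R z`. -/
noncomputable def latticeTransl (R : Matrix (Fin n) (Fin n) ℝ) :
    Multiplicative (Fin n → ℤ) →* Aff n :=
  transl.comp (AddMonoidHom.toMultiplicative
    (R.mulVecLin.toAddMonoidHom.comp ((Int.castAddHom ℝ).compLeft (Fin n))))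

theorem latticeTransl_ofAdd (R : Matrix (Fin n) (Fin n) ℝ) (z : Fin n → ℤ) :
    latticeTransl R (.ofAdd z) = transl (.ofAdd (R *ᵥ fun i => (z i : ℝ))) := rfl

/-- Criterion for `E ∩ D` to have finite index in `D`: the linear parts of `D` form a finite set,
the translations in `D` lie in a homomorphic image of `ℤⁿ`, and `E` contains the image of `N ℤⁿ` for
some `N ≠ 0`. -/
theorem relIndex_ne_zero {D E : Subgroup (Aff n)} (hD : (lin '' (D : Set (Aff n))).Finite)
    (φ : Multiplicative (Fin n → ℤ) →* Aff n)
    (hφ : ∀ v, transl (.ofAdd v) ∈ D → transl (.ofAdd v) ∈ φ.range) {N : ℕ} (hN : N ≠ 0)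
    (hE : ∀ z : Fin n → ℤ, φ (.ofAdd (N • z)) ∈ E) : E.relIndex D ≠ 0 := by
  have : NeZero N := ⟨hN⟩
  let ψ : Multiplicative (Fin n → ℤ) →* Multiplicative (Fin n → ZMod N) :=
    AddMonoidHom.toMultiplicative ((Int.castAddHom (ZMod N)).compLeft (Fin n))
  have h1 : ψ.ker ≤ E.comap φ := fun z hz => by
    have hz' : ∀ i, ((z.toAdd i : ℤ) : ZMod N) = 0 := fun i => congrFun hz i
    choose w hw using fun i => (ZMod.intCast_zmod_eq_zero_iff_dvd _ N).1 (hz' i)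
    have : z = .ofAdd (N • w) := by
      change z.toAdd = N • w
      ext i
      simp [hw]
    rw [this]
    exact hE w
  have h2 : E.relIndex φ.range ≠ 0 := by
    rw [← Subgroup.index_comap]
    exact (Subgroup.finiteIndex_of_le h1).index_ne_zero
  have h3 : lin.ker ⊓ D ≤ φ.range := fun f hf => by
    have h4 := eq_transl (f := f) hf.1
    rw [h4]
    exact hφ _ (h4 ▸ hf.2)
  refine Subgroup.relIndex_ne_zero_trans
    (mt (Subgroup.relIndex_eq_zero_of_le_right h3) h2) ?_
  rw [Subgroup.inf_relIndex_right, Subgroup.relIndex_ker]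
  have : Finite (D.map lin) := hD
  exact Nat.card_pos.ne'

theorem transl_mem_affInt_iff {v : Fin n → ℝ} :
    transl (.ofAdd v) ∈ affInt n ↔ ∃ z : Fin n → ℤ, v = fun i => (z i : ℝ) := by
  refine ⟨fun h => by simpa using h.1, fun h => ⟨by simpa using h, ?_⟩⟩
  rw [lin_transl]
  exact one_mem _

end Aff

/-! ### Groups whose translations form `ℤⁿ` -/

/-- `Γ` is a group of isometries of some Euclidean structure on `ℝⁿ`, and its translations are
exactly those by integral vectors. -/
structure IsNormalized {n : ℕ} (Γ : Subgroup (Aff n)) : Prop where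
  transl_mem_iff : ∀ v : Fin n → ℝ, Aff.transl (.ofAdd v) ∈ Γ ↔
    ∃ z : Fin n → ℤ, v = fun i => (z i : ℝ)
  exists_form : ∃ B : Matrix (Fin n) (Fin n) ℝ, B.PosDef ∧ Γ ≤ orthogonalAffine (formGroup B)

theorem Matrix.PosDef.transpose_mul_mul_GL {n : ℕ} {B : Matrix (Fin n) (Fin n) ℝ} (hB : B.PosDef)
    (X : GL (Fin n) ℝ) : (X.1ᵀ * B * X.1).PosDef := by
  have := hB.conjTranspose_mul_mul_same (B := X.1)
    (Matrix.mulVec_injective_iff_isUnit.2 X.isUnit)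
  rwa [Matrix.conjTranspose_eq_transpose_of_trivial] at this

theorem Matrix.exists_map_ratCast_mulVec_eq {n : ℕ} (A : Matrix (Fin n) (Fin n) ℚ)
    (z : Fin n → ℤ) : ∃ w : Fin n → ℤ,
      A.map (Rat.castHom ℝ) *ᵥ (fun i => ((A.den • z) i : ℝ)) = fun i => (w i : ℝ) := by
  refine ⟨A.num *ᵥ z, ?_⟩
  ext i
  have h : ∀ j, ((A i j : ℚ) : ℝ) * A.den = A.num i j := fun j => by
    have h0 : (A.den : ℚ) ≠ 0 := Nat.cast_ne_zero.2 A.den_ne_zero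
    have := (div_eq_iff h0).1 (A.num_div_den i j)
    rw [← Rat.cast_intCast (A.num i j), this]
    push_cast
    rfl
  simp [Matrix.mulVec, dotProduct, ← h, mul_assoc]

namespace IsNormalized

variable {n : ℕ} {Γ : Subgroup (Aff n)}

/-- Conjugation by `γ ∈ Γ` permutes the translations in `Γ`, so that the linear part of `γ` maps
`ℤⁿ` into itself. -/
theorem exists_int_matrix (h : IsNormalized Γ) {γ : Aff n} (hγ : γ ∈ Γ) :
    ∃ Z : Matrix (Fin n) (Fin n) ℤ,
      Z.map (Int.castRingHom ℝ) = (Aff.lin γ : Matrix (Fin n) (Fin n) ℝ) := by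
  have h1 : ∀ j, ∃ z : Fin n → ℤ,
      (Aff.lin γ : Matrix (Fin n) (Fin n) ℝ) *ᵥ Pi.single j 1 = fun i => (z i : ℝ) := fun j => by
    rw [← h.transl_mem_iff, ← Aff.conj_transl]
    refine mul_mem (mul_mem hγ ((h.transl_mem_iff _).2 ⟨Pi.single j 1, ?_⟩)) (inv_mem hγ)
    ext i
    simp [Pi.single_apply]
  choose z hz using h1
  refine ⟨.of fun i j => z j i, ?_⟩
  ext i j
  simpa using (congrFun (hz j) i).symm

theorem lin_mem_range (h : IsNormalized Γ) {γ : Aff n} (hγ : γ ∈ Γ) :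
    Aff.lin γ ∈ (GeneralLinearGroup.map (n := Fin n) (Int.castRingHom ℝ)).range := by
  obtain ⟨Z, hZ⟩ := h.exists_int_matrix hγ
  obtain ⟨W, hW⟩ := h.exists_int_matrix (inv_mem hγ)
  have hinj : Function.Injective fun M : Matrix (Fin n) (Fin n) ℤ => M.map (Int.castRingHom ℝ) :=
    Matrix.map_injective (RingHom.injective_int _)
  have h1 : Z * W = 1 := hinj <| by
    simp only [Matrix.map_mul, hZ, hW]
    rw [map_inv, Units.mul_inv]
    simp
  exact ⟨⟨Z, W, h1, mul_eq_one_comm.1 h1⟩, Units.ext hZ⟩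

/-- The linear parts are integral isometries of a positive definite form. -/
theorem finite_lin (h : IsNormalized Γ) : (Aff.lin '' (Γ : Set (Aff n))).Finite := by
  obtain ⟨B, hB, hΓ⟩ := h.exists_form
  refine hB.finite_integral_isometries.subset ?_
  rintro _ ⟨γ, hγ, rfl⟩
  exact ⟨hΓ hγ, h.lin_mem_range hγ⟩

/-- The linear parts form a finite group `H` of integral matrices, which therefore preserves the
integral positive definite form `∑ A ∈ H, Aᵀ A`. -/
theorem exists_rat_form (h : IsNormalized Γ) : ∃ B : Matrix (Fin n) (Fin n) ℚ,
    (B.map (fun q : ℚ => (q : ℝ))).PosDef ∧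
      Γ ≤ orthogonalAffine (formGroup (B.map (fun q : ℚ => (q : ℝ)))) := by
  have : Finite (Γ.map Aff.lin) := h.finite_lin
  have := Fintype.ofFinite (Γ.map Aff.lin)
  have h1 : ∀ A : Γ.map Aff.lin, ∃ Z : GL (Fin n) ℤ,
      GeneralLinearGroup.map (Int.castRingHom ℝ) Z = A := by
    rintro ⟨_, γ, hγ, rfl⟩
    exact h.lin_mem_range hγ
  choose Z hZ using h1
  let B : Matrix (Fin n) (Fin n) ℚ := ∑ A, ((Z A).1ᵀ * (Z A).1).map (Int.castRingHom ℚ)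
  have hB : B.map (fun q : ℚ => (q : ℝ)) = ∑ A : Γ.map Aff.lin, A.1.1ᵀ * A.1.1 := by
    ext i j
    simp_rw [← hZ]
    simp [B, Matrix.sum_apply, Matrix.mul_apply]
  refine ⟨B, ?_, fun γ hγ => ?_⟩
  · rw [hB]
    refine Matrix.posDef_sum Finset.univ_nonempty fun A _ => ?_
    simpa using Matrix.PosDef.one.transpose_mul_mul_GL A.1
  · change (Aff.lin γ).1ᵀ * _ * (Aff.lin γ).1 = _
    rw [hB, Finset.mul_sum, Finset.sum_mul]
    refine Fintype.sum_equiv (Equiv.mulRight ⟨Aff.lin γ, γ, hγ, rfl⟩) _ _ fun A => ?_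
    simp [Matrix.mul_assoc]

/-- A conjugate of `Γ` by an affine map with rational linear part is `ℚ`-arithmetic. The
translational part of the conjugating map is irrelevant: commensurability with `O_K(n; ℤ)` only
depends on the lattice of translations. -/
theorem isQArithmeticIn_conj (h : IsNormalized Γ) {x : Aff n} {R : GL (Fin n) ℚ}
    (hx : Aff.lin x = GeneralLinearGroup.map (Rat.castHom ℝ) R) :
    ∃ K : Subgroup (GL (Fin n) ℝ), IsMaximalCompact K ∧ IsQDefined K ∧
      IsQArithmeticIn K (Γ.map (MulAut.conj x).toMonoidHom) := by
  obtain ⟨B, hB, hΓ⟩ := h.exists_rat_form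
  have hB' : ((R⁻¹).1ᵀ * B * (R⁻¹).1).map (fun q : ℚ => (q : ℝ)) =
      ((Aff.lin x)⁻¹).1ᵀ * B.map (fun q : ℚ => (q : ℝ)) * ((Aff.lin x)⁻¹).1 := by
    rw [hx, ← map_inv]
    change (_ : Matrix _ _ ℚ).map (Rat.castHom ℝ) = _
    rw [Matrix.map_mul, Matrix.map_mul]
    rfl
  have hpos := hB.transpose_mul_mul_GL (Aff.lin x)⁻¹
  have hle := Aff.map_conj_le_orthogonalAffine hΓ x
  refine ⟨_, hpos.isMaximalCompact_formGroup, ⟨_, by rwa [hB'], by rw [hB']⟩, hle, ?_, ?_⟩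
  · refine Aff.relIndex_ne_zero (hpos.finite_integral_isometries.subset ?_)
      (Aff.latticeTransl 1) (fun v hv => ?_) (R⁻¹).1.den_ne_zero fun z => ?_
    · rintro _ ⟨f, hf, rfl⟩
      exact ⟨hf.1, hf.2.2⟩
    · obtain ⟨z, rfl⟩ := Aff.transl_mem_affInt_iff.1 hv.2
      exact ⟨.ofAdd z, by rw [Aff.latticeTransl_ofAdd, Matrix.one_mulVec]⟩
    · rw [Aff.latticeTransl_ofAdd, Matrix.one_mulVec, Aff.transl_mem_map_conj_iff,
        h.transl_mem_iff, hx, ← map_inv]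
      exact (R⁻¹).1.exists_map_ratCast_mulVec_eq z
  · refine Aff.relIndex_ne_zero ?_ (Aff.latticeTransl (Aff.lin x).1) (fun v hv => ?_)
      R.1.den_ne_zero fun z => ⟨?_, ?_⟩
    · refine (h.finite_lin.image fun A => Aff.lin x * A * (Aff.lin x)⁻¹).subset ?_
      rintro _ ⟨_, ⟨γ, hγ, rfl⟩, rfl⟩
      exact ⟨_, ⟨γ, hγ, rfl⟩, by simp⟩
    · obtain ⟨z, hz⟩ := (h.transl_mem_iff _).1 (Aff.transl_mem_map_conj_iff.1 hv)
      refine ⟨.ofAdd z, ?_⟩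
      rw [Aff.latticeTransl_ofAdd, ← hz, Matrix.mulVec_mulVec, Units.mul_inv, Matrix.one_mulVec]
    · change Aff.lin _ ∈ formGroup _
      rw [Aff.latticeTransl_ofAdd, Aff.lin_transl]
      exact one_mem _
    · rw [Aff.latticeTransl_ofAdd]
      refine Aff.transl_mem_affInt_iff.2 ?_
      rw [hx]
      exact R.1.exists_map_ratCast_mulVec_eq z

end IsNormalized

theorem IsBieberbach.exists_isNormalized {n : ℕ} {Γ : Subgroup (Aff n)} (h : IsBieberbach Γ) :
    ∃ x : Aff n, IsNormalized (Γ.map (MulAut.conj x).toMonoidHom) := by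
  obtain ⟨P, hP⟩ := h.exists_lattice_basis
  refine ⟨Aff.ofGL P⁻¹, fun v => ?_, _, ?_, Aff.map_conj_le_orthogonalAffine h.le_euc _⟩
  · rw [Aff.transl_mem_map_conj_iff, hP, Aff.lin_ofGL, inv_inv]
    exact exists_congr fun z => (Matrix.mulVec_injective_iff_isUnit.2 P.isUnit).eq_iff
  · exact Matrix.PosDef.one.transpose_mul_mul_GL _

/-! ### Deformation of a representation by conjugation -/

theorem range_conj_comp {n : ℕ} {Γ : Subgroup (Aff n)} (ρ : Γ →* Aff n) (x : Aff n) :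
    ((MulAut.conj x).toMonoidHom.comp ρ).range = ρ.range.map (MulAut.conj x).toMonoidHom :=
  MonoidHom.range_comp _ _

/-- The representation `ρ` followed by conjugation by the linear map with matrix `X`. -/
noncomputable def conjRep {n : ℕ} {Γ : Subgroup (Aff n)} (ρ : faithfulReps Γ) (X : GL (Fin n) ℝ) :
    faithfulReps Γ :=
  ⟨(MulAut.conj (Aff.ofGL X)).toMonoidHom.comp (ρ : Γ →* Aff n),
    (MulAut.conj (Aff.ofGL X)).injective.comp ρ.2.1, by
      obtain ⟨g, hg⟩ := ρ.2.2
      refine ⟨g * (Aff.ofGL X)⁻¹, ?_⟩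
      rwa [range_conj_comp, Subgroup.map_conj_map_conj, inv_mul_cancel_right]⟩

theorem continuous_conjRep {n : ℕ} {Γ : Subgroup (Aff n)} (ρ : faithfulReps Γ) :
    Continuous (conjRep ρ) := by
  refine Continuous.subtype_mk (continuous_induced_rng.2 (continuous_pi fun γ =>
    continuous_induced_rng.2 ?_)) _
  have : (fun X : GL (Fin n) ℝ => (X.1 *ᵥ (ρ : Γ →* Aff n) γ 0,
      X * Aff.lin ((ρ : Γ →* Aff n) γ) * X⁻¹)) = (fun f : Aff n => (f 0, Aff.lin f)) ∘
      fun X => (conjRep ρ X : Γ →* Aff n) γ := by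
    ext1 X
    change _ = ((Aff.ofGL X * (ρ : Γ →* Aff n) γ * (Aff.ofGL X)⁻¹) 0,
      Aff.lin (Aff.ofGL X * (ρ : Γ →* Aff n) γ * (Aff.ofGL X)⁻¹))
    rw [Aff.conj_ofGL_zero, map_mul, map_mul, map_inv, Aff.lin_ofGL]
  change Continuous ((fun f : Aff n => (f 0, Aff.lin f)) ∘
      fun X => (conjRep ρ X : Γ →* Aff n) γ)
  rw [← this]
  exact (Units.continuous_val.matrix_mulVec continuous_const).prodMk (by fun_prop)

theorem conjRep_one {n : ℕ} {Γ : Subgroup (Aff n)} (ρ : faithfulReps Γ) : conjRep ρ 1 = ρ := by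
  have h1 : Aff.ofGL (1 : GL (Fin n) ℝ) = 1 := Aff.ext_lin (by simp) (by simp)
  refine Subtype.ext (MonoidHom.ext fun γ => ?_)
  change Aff.ofGL 1 * _ * (Aff.ofGL 1)⁻¹ = _
  rw [h1, one_mul, inv_one, mul_one]

theorem propositionP (n : ℕ) (Γ : Subgroup (Aff n)) (hΓ : IsBieberbach Γ) :
    Dense {ρ : faithfulReps Γ | IsQArithmetic (ρ : Γ →* Aff n)} := by
  intro ρ
  -- Move `ρ` by matrices `X → 1` such that `X * (lin f)⁻¹` is rational, where `f` conjugates the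
  -- image of `ρ` to a group whose translations are those by `ℤⁿ`.
  obtain ⟨g, hg⟩ := ρ.2.2
  obtain ⟨x, hx⟩ := hg.exists_isNormalized
  rw [Subgroup.map_conj_map_conj] at hx
  set f := x * g
  have h1 : DenseRange fun R : GL (Fin n) ℚ =>
      GeneralLinearGroup.map (Rat.castHom ℝ) R * Aff.lin f :=
    (Homeomorph.mulRight (Aff.lin f)).surjective.denseRange.comp denseRange_GL_rat
      (Homeomorph.mulRight (Aff.lin f)).continuous
  rw [← conjRep_one ρ]
  refine map_mem_closure (continuous_conjRep ρ) (h1 1) ?_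
  rintro _ ⟨R, rfl⟩
  obtain ⟨K, hK, hQ, hA⟩ := hx.isQArithmeticIn_conj
    (x := Aff.ofGL (GeneralLinearGroup.map (Rat.castHom ℝ) R * Aff.lin f) * f⁻¹) (R := R)
    (by rw [map_mul, Aff.lin_ofGL, map_inv, mul_inv_cancel_right])
  refine ⟨K, hK, hQ, ?_⟩
  rw [Subgroup.map_conj_map_conj, inv_mul_cancel_right, ← range_conj_comp] at hA
  exact hA
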